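/- Let $M$ be a smooth ($C^\infty$) finite-dimensional manifold without boundary, and let $g$ be a smooth semi-Riemannian metric on $M$ (symmetric and nondegenerate, of arbitrary signature), with Levi-Civita connection $\nabla$. For $X\in T_pM$ and $u\in T_pM$, let $X^V, X^H\in T_u(TM)$ denote the vertical lift of $X$ and the horizontal lift of $X$ with respect to $\nabla$; in the coordinates $(x^i,y^i)$ of $TM$ induced by coordinates $(x^i)$ of $M$, $$X^V=X^i\frac{\partial}{\partial y^i},\qquad X^H=X^i\frac{\partial}{\partial x^i}-\Gamma^k_{ij}X^iu^j\frac{\partial}{\partial y^k}.$$ Let $\hat g$ be the complete lift of $g$ to the tangent bundle $TM$, that is, the field of bilinear forms on $TM$ determined by $$\hat g(X^H,Y^H)=\hat g(X^V,Y^V)=0,\qquad \hat g(X^H,Y^V)=\hat g(X^V,Y^H)=g(X,Y)$$ for all $X,Y\in T_pM$, at every $u\in T_pM$. Then $\hat g$ is a smooth semi-Riemannian metric on $TM$, and: (i) $(TM,\hat g)$ is flat if and only if $(M,g)$ is flat; (ii) $(TM,\hat g)$ is Ricci flat if and only if $(M,g)$ is Ricci flat; (iii) $(TM,\hat g)$ is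 scalar flat. Here a semi-Riemannian manifold is called flat, Ricci flat or scalar flat if, respectively, the curvature tensor $R(X,Y)Z=\nabla_X\nabla_YZ-\nabla_Y\nabla_XZ-\nabla_{[X,Y]}Z$ of its Levi-Civita connection, its Ricci tensor $\rho(Y,Z)=\operatorname{tr}(X\mapsto R(X,Y)Z)$, or its scalar curvature (the trace of $\rho$ with respect to the metric) vanishes identically. -/

import Mathlib

set_option maxSynthPendingDepth 3

open scoped Manifold ContDiff
open Bundle

/-! ### Levi-Civita connection and curvature of a metric on (an open subset of) a vector space -/

namespace CoordMetric

variable {E : Type*} [NormedAddCommGroup E] [NormedSpace ℝ E]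

/-- The Koszul expression of a field of bilinear forms `G` on `E` at `x`: the trilinear form
`(v, w, z) ↦ (1/2) (∂_v G(w, z) + ∂_w G(v, z) - ∂_z G(v, w))`. -/
noncomputable def koszul (G : E → E →L[ℝ] E →L[ℝ] ℝ) (x : E) :
    E →L[ℝ] E →L[ℝ] E →L[ℝ] ℝ :=
  (1 / 2 : ℝ) • (fderiv ℝ G x + (fderiv ℝ G x).flip -
    (ContinuousLinearMap.flipₗᵢ ℝ E E ℝ).toContinuousLinearEquiv.toContinuousLinearMap ∘L
      (fderiv ℝ G x).flip)

theorem koszul_apply (G : E → E →L[ℝ] E →L[ℝ] ℝ) (x v w z : E) :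
    koszul G x v w z =
      (1 / 2 : ℝ) * (fderiv ℝ G x v w z + fderiv ℝ G x w v z - fderiv ℝ G x z v w) := by
  simp [koszul]

/-- The Christoffel symbols `Γ_x(v, w)` of the Levi-Civita connection of `G`, so that
`(∇_v W)(x) = ∂_v W(x) + Γ_x(v, W x)`. The index of the Koszul expression is raised with `G x`,
seen as a map from `E` to its dual. -/
noncomputable def christoffel (G : E → E →L[ℝ] E →L[ℝ] ℝ) (x : E) : E →L[ℝ] E →L[ℝ] E :=
  ContinuousLinearMap.compL ℝ E (E →L[ℝ] ℝ) E (G x).inverse ∘L koszul G x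

theorem christoffel_apply (G : E → E →L[ℝ] E →L[ℝ] ℝ) (x v w : E) :
    christoffel G x v w = (G x).inverse (koszul G x v w) := rfl

/-- The curvature `R(u, v)w = ∇_u ∇_v w - ∇_v ∇_u w - ∇_[u,v] w` at `x`, in terms of the
Christoffel symbols. -/
noncomputable def riemann (G : E → E →L[ℝ] E →L[ℝ] ℝ) (x u v w : E) : E :=
  fderiv ℝ (christoffel G) x u v w - fderiv ℝ (christoffel G) x v u w
    + christoffel G x u (christoffel G x v w) - christoffel G x v (christoffel G x u w)

/-- The endomorphism `u ↦ R(u, v)w`. -/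
noncomputable def riemannEnd (G : E → E →L[ℝ] E →L[ℝ] ℝ) (x v w : E) : E →ₗ[ℝ] E where
  toFun u := riemann G x u v w
  map_add' a b := by simp only [riemann, map_add, add_apply]; abel
  map_smul' c a := by
    simp only [riemann, map_smul, smul_apply, RingHom.id_apply, smul_sub,
      smul_add]

/-- The Ricci tensor `ρ(v, w) = tr (u ↦ R(u, v)w)`. -/
noncomputable def ricci (G : E → E →L[ℝ] E →L[ℝ] ℝ) (x : E) : E →ₗ[ℝ] E →ₗ[ℝ] ℝ :=
  LinearMap.mk₂ ℝ (fun v w ↦ LinearMap.trace ℝ E (riemannEnd G x v w))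
    (fun a b w ↦ by
      rw [← map_add]; congr 1; ext u
      simp only [riemannEnd, riemann, LinearMap.coe_mk, AddHom.coe_mk, LinearMap.add_apply,
        map_add, add_apply]; abel)
    (fun c a w ↦ by
      rw [← map_smul]; congr 1; ext u
      simp only [riemannEnd, riemann, LinearMap.coe_mk, AddHom.coe_mk, LinearMap.smul_apply,
        map_smul, smul_apply, smul_sub, smul_add])
    (fun v a b ↦ by
      rw [← map_add]; congr 1; ext u
      simp only [riemannEnd, riemann, LinearMap.coe_mk, AddHom.coe_mk, LinearMap.add_apply,
        map_add]; abel)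
    (fun c v a ↦ by
      rw [← map_smul]; congr 1; ext u
      simp only [riemannEnd, riemann, LinearMap.coe_mk, AddHom.coe_mk, LinearMap.smul_apply,
        map_smul, smul_sub, smul_add])

theorem ricci_apply (G : E → E →L[ℝ] E →L[ℝ] ℝ) (x v w : E) :
    ricci G x v w = LinearMap.trace ℝ E (riemannEnd G x v w) := rfl

/-- The scalar curvature: the trace of the Ricci tensor with respect to `G x`, that is, the trace
of the endomorphism obtained by raising one index of the Ricci tensor. -/
noncomputable def scalar [FiniteDimensional ℝ E] (G : E → E →L[ℝ] E →L[ℝ] ℝ) (x : E) : ℝ :=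
  LinearMap.trace ℝ E ((G x).inverse.toLinearMap ∘ₗ
    (LinearMap.toContinuousLinearMap (𝕜 := ℝ) (E := E) (F' := ℝ)).toLinearMap ∘ₗ ricci G x)

end CoordMetric

/-! ### Semi-Riemannian manifolds -/

section Manifold

variable {E : Type*} [NormedAddCommGroup E] [NormedSpace ℝ E]
  {H : Type*} [TopologicalSpace H] (I : ModelWithCorners ℝ E H)
  {M : Type*} [TopologicalSpace M] [ChartedSpace H M]

/-- A field `g` of bilinear forms on the tangent spaces of `M` is a (smooth) semi-Riemannian
metric if it is symmetric and nondegenerate, of any signature, and smooth as a section of the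
bundle of bilinear forms. -/
structure IsSemiRiemannianMetric [IsManifold I ∞ M]
    (g : ∀ p : M, TangentSpace I p →L[ℝ] TangentSpace I p →L[ℝ] ℝ) : Prop where
  symm : ∀ (p : M) (v w : TangentSpace I p), g p v w = g p w v
  nondegenerate : ∀ (p : M) (v : TangentSpace I p), (∀ w, g p v w = 0) → v = 0
  contMDiff : ContMDiff I (I.prod 𝓘(ℝ, E →L[ℝ] E →L[ℝ] ℝ)) ∞
    (fun p ↦ TotalSpace.mk' (E →L[ℝ] E →L[ℝ] ℝ)
      (E := fun q : M ↦ TangentSpace I q →L[ℝ] TangentSpace I q →L[ℝ] ℝ) p (g p))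

/-- The coordinate expression of `g` in the preferred chart `φ` at `p`, i.e. the pullback of `g`
by `φ⁻¹`, as a function on (the image of `φ` in) the model vector space `E`. -/
noncomputable def localMetric
    (g : ∀ p : M, TangentSpace I p →L[ℝ] TangentSpace I p →L[ℝ] ℝ) (p : M) (x : E) :
    E →L[ℝ] E →L[ℝ] ℝ :=
  let B : E →L[ℝ] E →L[ℝ] ℝ := g ((extChartAt I p).symm x)
  let A : E →L[ℝ] E := mfderiv 𝓘(ℝ, E) I (extChartAt I p).symm x
  B.bilinearComp A A

/-! In Mathlib the tangent space `TangentSpace I p` is the model space `E`, a vector being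
identified with its coordinates in the preferred chart at `p`. A tensor at `p` is thus given by its
components at `p` in this chart. -/

/-- The Christoffel symbols at `p` of the Levi-Civita connection of `g`, in the preferred chart
at `p`. -/
noncomputable def christoffelAt
    (g : ∀ p : M, TangentSpace I p →L[ℝ] TangentSpace I p →L[ℝ] ℝ) (p : M) :
    TangentSpace I p →L[ℝ] TangentSpace I p →L[ℝ] TangentSpace I p :=
  (CoordMetric.christoffel (E := E) (localMetric I g p) (extChartAt I p p) : E →L[ℝ] E →L[ℝ] E)

/-- The curvature tensor `R(u, v)w` at `p` of the Levi-Civita connection of `g`. -/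
noncomputable def riemannTensor
    (g : ∀ p : M, TangentSpace I p →L[ℝ] TangentSpace I p →L[ℝ] ℝ) (p : M)
    (u v w : TangentSpace I p) : TangentSpace I p :=
  (CoordMetric.riemann (E := E) (localMetric I g p) (extChartAt I p p) (u : E) (v : E) (w : E) : E)

/-- The Ricci tensor of `g` at `p`. -/
noncomputable def ricciTensor
    (g : ∀ p : M, TangentSpace I p →L[ℝ] TangentSpace I p →L[ℝ] ℝ) (p : M)
    (v w : TangentSpace I p) : ℝ :=
  CoordMetric.ricci (E := E) (localMetric I g p) (extChartAt I p p) v w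

/-- The scalar curvature of `g` at `p`. -/
noncomputable def scalarCurvature [FiniteDimensional ℝ E]
    (g : ∀ p : M, TangentSpace I p →L[ℝ] TangentSpace I p →L[ℝ] ℝ) (p : M) : ℝ :=
  CoordMetric.scalar (localMetric I g p) (extChartAt I p p)

/-- `(M, g)` is flat: the curvature tensor vanishes identically. -/
def IsFlat (g : ∀ p : M, TangentSpace I p →L[ℝ] TangentSpace I p →L[ℝ] ℝ) : Prop :=
  ∀ (p : M) (u v w : TangentSpace I p), riemannTensor I g p u v w = 0

/-- `(M, g)` is Ricci flat: the Ricci tensor vanishes identically. -/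
def IsRicciFlat (g : ∀ p : M, TangentSpace I p →L[ℝ] TangentSpace I p →L[ℝ] ℝ) : Prop :=
  ∀ (p : M) (v w : TangentSpace I p), ricciTensor I g p v w = 0

/-- `(M, g)` is scalar flat: the scalar curvature vanishes identically. -/
def IsScalarFlat [FiniteDimensional ℝ E]
    (g : ∀ p : M, TangentSpace I p →L[ℝ] TangentSpace I p →L[ℝ] ℝ) : Prop :=
  ∀ p : M, scalarCurvature I g p = 0

/-! ### Horizontal and vertical lifts, and the complete lift of the metric

Let `x` be the preferred chart of `M` at `p`. The preferred chart of `TM` at a point `U` of `T_p M`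
is the induced chart `(x, y)`, where `y` are the components of tangent vectors in the chart `x`.
So `T_U (TM)` is `E × E`, the pair `(a, b)` being `a^i ∂/∂x^i + b^i ∂/∂y^i`. -/

variable [IsManifold I ∞ M]

/-- The vertical lift `X^V` to `T_U (TM)` of a vector `X` in `T_p M`, where `U` is in `T_p M`:
`X^V = X^i ∂/∂y^i`. -/
noncomputable def verticalLift (U : TangentBundle I M) :
    TangentSpace I U.proj →L[ℝ] TangentSpace I.tangent U :=
  (ContinuousLinearMap.inr ℝ E E : E →L[ℝ] E × E)

/-- The horizontal lift `X^H` to `T_U (TM)` of a vector `X` in `T_p M` with respect to the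
Levi-Civita connection of `g`, where `U` is in `T_p M`:
`X^H = X^i ∂/∂x^i - Γ^k_{ij} X^i U^j ∂/∂y^k`. -/
noncomputable def horizontalLift
    (g : ∀ p : M, TangentSpace I p →L[ℝ] TangentSpace I p →L[ℝ] ℝ) (U : TangentBundle I M) :
    TangentSpace I U.proj →L[ℝ] TangentSpace I.tangent U :=
  let Γ : E →L[ℝ] E →L[ℝ] E := christoffelAt I g U.proj
  let y : E := U.snd
  ((ContinuousLinearMap.id ℝ E).prod (-(Γ.flip y)) : E →L[ℝ] E × E)

/-- The vector `X` with `ξ = X^H + Y^V` (see `eq_horizontalLift_add_verticalLift`): the image of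
`ξ` under the differential of the projection `TM → M`. -/
noncomputable def horizontalPart (U : TangentBundle I M) :
    TangentSpace I.tangent U →L[ℝ] TangentSpace I U.proj :=
  (ContinuousLinearMap.fst ℝ E E : E × E →L[ℝ] E)

/-- The vector `Y` with `ξ = X^H + Y^V` (see `eq_horizontalLift_add_verticalLift`): the image of
`ξ` under the connection map. -/
noncomputable def verticalPart
    (g : ∀ p : M, TangentSpace I p →L[ℝ] TangentSpace I p →L[ℝ] ℝ) (U : TangentBundle I M) :
    TangentSpace I.tangent U →L[ℝ] TangentSpace I U.proj :=
  let Γ : E →L[ℝ] E →L[ℝ] E := christoffelAt I g U.proj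
  let y : E := U.snd
  (ContinuousLinearMap.snd ℝ E E + Γ.flip y ∘L ContinuousLinearMap.fst ℝ E E : E × E →L[ℝ] E)

/-- The complete lift of `g` to `TM`: for `ξ = X^H + Y^V` and `η = X'^H + Y'^V`,
`ĝ(ξ, η) = g(X, Y') + g(Y, X')`. -/
noncomputable def completeLift
    (g : ∀ p : M, TangentSpace I p →L[ℝ] TangentSpace I p →L[ℝ] ℝ) (U : TangentBundle I M) :
    TangentSpace I.tangent U →L[ℝ] TangentSpace I.tangent U →L[ℝ] ℝ :=
  let B : E →L[ℝ] E →L[ℝ] ℝ := g U.proj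
  let h : E × E →L[ℝ] E := horizontalPart I U
  let k : E × E →L[ℝ] E := verticalPart I g U
  (B.bilinearComp h k + B.bilinearComp k h : E × E →L[ℝ] E × E →L[ℝ] ℝ)

section Lifts

variable (g : ∀ p : M, TangentSpace I p →L[ℝ] TangentSpace I p →L[ℝ] ℝ) (U : TangentBundle I M)

theorem horizontalPart_horizontalLift (X : TangentSpace I U.proj) :
    horizontalPart I U (horizontalLift I g U X) = X := rfl

theorem horizontalPart_verticalLift (X : TangentSpace I U.proj) :
    horizontalPart I U (verticalLift I U X) = 0 := rfl

theorem verticalPart_horizontalLift (X : TangentSpace I U.proj) :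
    verticalPart I g U (horizontalLift I g U X) = 0 :=
  neg_add_cancel (G := E) _

theorem verticalPart_verticalLift (X : TangentSpace I U.proj) :
    verticalPart I g U (verticalLift I U X) = X := by
  have h : ∀ (Γ : E →L[ℝ] E →L[ℝ] E) (a b : E), a + Γ 0 b = a := by simp
  exact h (christoffelAt I g U.proj) X U.snd

theorem eq_horizontalLift_add_verticalLift (ξ : TangentSpace I.tangent U) :
    ξ = horizontalLift I g U (horizontalPart I U ξ) +
      verticalLift I U (verticalPart I g U ξ) := by
  have h : ∀ (a b c : E), ((a, b) : E × E) = (a, -c) + (0, b + c) := by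
    intro a b c; ext <;> simp
  exact h ξ.1 ξ.2 _

theorem completeLift_apply (ξ η : TangentSpace I.tangent U) :
    completeLift I g U ξ η =
      g U.proj (horizontalPart I U ξ) (verticalPart I g U η) +
        g U.proj (verticalPart I g U ξ) (horizontalPart I U η) := rfl

theorem completeLift_horizontal_horizontal (X Y : TangentSpace I U.proj) :
    completeLift I g U (horizontalLift I g U X) (horizontalLift I g U Y) = 0 := by
  rw [completeLift_apply, verticalPart_horizontalLift, verticalPart_horizontalLift]; simp

theorem completeLift_vertical_vertical (X Y : TangentSpace I U.proj) :
    completeLift I g U (verticalLift I U X) (verticalLift I U Y) = 0 := by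
  rw [completeLift_apply, horizontalPart_verticalLift, horizontalPart_verticalLift]; simp

theorem completeLift_horizontal_vertical (X Y : TangentSpace I U.proj) :
    completeLift I g U (horizontalLift I g U X) (verticalLift I U Y) = g U.proj X Y := by
  rw [completeLift_apply, verticalPart_horizontalLift, horizontalPart_verticalLift,
    horizontalPart_horizontalLift, verticalPart_verticalLift]; simp

theorem completeLift_vertical_horizontal (X Y : TangentSpace I U.proj) :
    completeLift I g U (verticalLift I U X) (horizontalLift I g U Y) = g U.proj X Y := by
  rw [completeLift_apply, verticalPart_horizontalLift, horizontalPart_verticalLift,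
    horizontalPart_horizontalLift, verticalPart_verticalLift]; simp

end Lifts

end Manifold

/-!
In the charts `(x, y)` of `TM` induced by charts of `M`, the complete lift of `g` is the derivative
of `g`: its components at `(x, y)` are `dg_x(y)` on pairs of `∂/∂x`, `g_x` on mixed pairs and `0` on
pairs of `∂/∂y`. Differentiating the identities that define the Christoffel symbols and the
curvature of `g` shows that those of the complete lift are, likewise, `(Γ, dΓ)` and `(R, dR)`.
Hence the lift is flat exactly when `g` is. The endomorphism `ζ ↦ R̂(ζ, ξ)η` is block triangular
for the vertical subspace, with two diagonal blocks equal to `u ↦ R(u, dπ ξ) dπ η`, so the Ricci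
tensor of the lift is `2 ρ(dπ ξ, dπ η)`. Raising an index of it gives an endomorphism that kills the
vertical vectors and takes vertical values, so its trace, the scalar curvature, vanishes.

`riemannTensor` and `completeLift` are evaluated at each point in the preferred chart there. To read
them off in a fixed chart near the point, one needs the naturality of the complete lift and of the
curvature under changes of coordinates.
-/

open Topology

namespace CoordMetric

section Calculus

variable {E E₁ E₂ F : Type*} [NormedAddCommGroup E] [NormedSpace ℝ E]
  [NormedAddCommGroup E₁] [NormedSpace ℝ E₁] [NormedAddCommGroup E₂] [NormedSpace ℝ E₂]
  [NormedAddCommGroup F] [NormedSpace ℝ F] {x : E}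

theorem fderiv_bilin_apply {B : E → E₁ →L[ℝ] E₂ →L[ℝ] F} {f : E → E₁} {h : E → E₂}
    (hB : DifferentiableAt ℝ B x) (hf : DifferentiableAt ℝ f x) (hh : DifferentiableAt ℝ h x)
    (u : E) :
    fderiv ℝ (fun y ↦ B y (f y) (h y)) x u =
      fderiv ℝ B x u (f x) (h x) + B x (fderiv ℝ f x u) (h x) + B x (f x) (fderiv ℝ h x u) := by
  rw [fderiv_clm_apply (hB.clm_apply hf) hh, fderiv_clm_apply hB hf]
  simp [add_comm]

theorem fderiv_bilin_apply_const {B : E → E₁ →L[ℝ] E₂ →L[ℝ] F} (hB : DifferentiableAt ℝ B x)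
    (u : E) (a : E₁) (b : E₂) : fderiv ℝ (fun y ↦ B y a b) x u = fderiv ℝ B x u a b := by
  simp [fderiv_bilin_apply hB (differentiableAt_const a) (differentiableAt_const b)]

theorem fderiv_trilin_apply_const {E₃ : Type*} [NormedAddCommGroup E₃] [NormedSpace ℝ E₃]
    {T : E → E₁ →L[ℝ] E₂ →L[ℝ] E₃ →L[ℝ] F} (hT : DifferentiableAt ℝ T x)
    (u : E) (a : E₁) (b : E₂) (c : E₃) :
    fderiv ℝ (fun y ↦ T y a b c) x u = fderiv ℝ T x u a b c := by
  rw [fderiv_bilin_apply_const (hT.clm_apply (differentiableAt_const a)),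
    fderiv_clm_apply hT (differentiableAt_const a)]
  simp

theorem fderiv_comp_fst {f : E → F} {z : E × E₁} (hf : DifferentiableAt ℝ f z.1) (ζ : E × E₁) :
    fderiv ℝ (fun y : E × E₁ ↦ f y.1) z ζ = fderiv ℝ f z.1 ζ.1 := by
  have hcomp : HasFDerivAt (fun y : E × E₁ ↦ f y.1) _ z := hf.hasFDerivAt.comp z hasFDerivAt_fst
  simp [hcomp.fderiv]

theorem fderiv_fderiv_comm {f : E → F} (hf : ContDiffAt ℝ 2 f x) (u v : E) :
    fderiv ℝ (fderiv ℝ f) x u v = fderiv ℝ (fderiv ℝ f) x v u :=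
  hf.isSymmSndFDerivAt (by simp) u v

theorem differentiableAt_fderiv {f : E → F} (hf : ContDiffAt ℝ 2 f x) :
    DifferentiableAt ℝ (fderiv ℝ f) x :=
  (hf.fderiv_right (m := 1) (by norm_num)).differentiableAt (by simp)

theorem contDiffAt_flip {n : WithTop ℕ∞} {B : E → E₁ →L[ℝ] E₂ →L[ℝ] F} (hB : ContDiffAt ℝ n B x) :
    ContDiffAt ℝ n (fun y ↦ (B y).flip) x :=
  (ContinuousLinearMap.flipₗᵢ ℝ E₁ E₂ F).contDiff.contDiffAt.comp x hB

theorem contDiffAt_bilinearComp {E₃ E₄ : Type*} [NormedAddCommGroup E₃] [NormedSpace ℝ E₃]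
    [NormedAddCommGroup E₄] [NormedSpace ℝ E₄] {n : WithTop ℕ∞} {B : E → E₁ →L[ℝ] E₂ →L[ℝ] F}
    {a : E → E₃ →L[ℝ] E₁} {b : E → E₄ →L[ℝ] E₂} (hB : ContDiffAt ℝ n B x)
    (ha : ContDiffAt ℝ n a x) (hb : ContDiffAt ℝ n b x) :
    ContDiffAt ℝ n (fun y ↦ (B y).bilinearComp (a y) (b y)) x :=
  contDiffAt_flip ((contDiffAt_flip (hB.clm_comp ha)).clm_comp hb)

theorem isInvertible_of_injective [FiniteDimensional ℝ E] {B : E →L[ℝ] E →L[ℝ] ℝ}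
    (hB : Function.Injective B) : B.IsInvertible := by
  have hdim : Module.finrank ℝ E = Module.finrank ℝ (E →L[ℝ] ℝ) :=
    (Subspace.dual_finrank_eq (K := ℝ) (V := E)).symm.trans
      LinearMap.toContinuousLinearMap.finrank_eq
  exact ⟨(LinearEquiv.ofInjectiveOfFinrankEq B.toLinearMap hB hdim).toContinuousLinearEquiv, rfl⟩

end Calculus

section Metric

variable {E : Type*} [NormedAddCommGroup E] [NormedSpace ℝ E]
  {G : E → E →L[ℝ] E →L[ℝ] ℝ} {x : E} {m n : WithTop ℕ∞}

theorem contDiffAt_koszul (hG : ContDiffAt ℝ m G x) (hmn : n + 1 ≤ m) :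
    ContDiffAt ℝ n (koszul G) x := by
  have hD := hG.fderiv_right hmn
  exact contDiffAt_const.smul (f := fun _ ↦ (1 / 2 : ℝ)) ((hD.add (contDiffAt_flip hD)).sub
    (contDiffAt_const.clm_comp (contDiffAt_flip hD)))

theorem fderiv_koszul (hG : ContDiffAt ℝ 2 G x) (u v w z : E) :
    fderiv ℝ (koszul G) x u v w z = (1 / 2 : ℝ) * (fderiv ℝ (fderiv ℝ G) x u v w z +
      fderiv ℝ (fderiv ℝ G) x u w v z - fderiv ℝ (fderiv ℝ G) x u z v w) := by
  have hK : DifferentiableAt ℝ (koszul G) x :=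
    (contDiffAt_koszul (n := 1) hG (by norm_num)).differentiableAt (by simp)
  have hD (a b c : E) : DifferentiableAt ℝ (fun y ↦ fderiv ℝ G y a b c) x :=
    (((differentiableAt_fderiv hG).clm_apply (differentiableAt_const a)).clm_apply
      (differentiableAt_const b)).clm_apply (differentiableAt_const c)
  have hKvwz : (fun y ↦ koszul G y v w z) = fun y ↦ (1 / 2 : ℝ) *
      (fderiv ℝ G y v w z + fderiv ℝ G y w v z - fderiv ℝ G y z v w) :=
    funext fun y ↦ koszul_apply G y v w z
  rw [← fderiv_trilin_apply_const hK, hKvwz,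
    fderiv_const_mul (((hD v w z).fun_add (hD w v z)).fun_sub (hD z v w)),
    fderiv_fun_sub ((hD v w z).fun_add (hD w v z)) (hD z v w),
    fderiv_fun_add (hD v w z) (hD w v z)]
  simp only [smul_apply, sub_apply, add_apply, smul_eq_mul,
    fderiv_trilin_apply_const (differentiableAt_fderiv hG)]

theorem apply_christoffel (hG : (G x).IsInvertible) (v w : E) :
    G x (christoffel G x v w) = koszul G x v w := by
  rw [christoffel_apply, hG.self_apply_inverse]

theorem christoffel_eq_of_apply_eq (hG : (G x).IsInvertible) {v w c : E}
    (h : koszul G x v w = G x c) : christoffel G x v w = c := by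
  rw [christoffel_apply, hG.inverse_apply_eq, h]

theorem contDiffAt_christoffel [CompleteSpace E] (hG : ContDiffAt ℝ m G x)
    (hx : (G x).IsInvertible) (hmn : n + 1 ≤ m) : ContDiffAt ℝ n (christoffel G) x :=
  (contDiffAt_const.clm_apply (hx.contDiffAt_map_inverse.comp x
    (hG.of_le (le_self_add.trans hmn)))).clm_comp (contDiffAt_koszul hG hmn)

/-- `G` restricts to a smooth semi-Riemannian metric on the open set `Ω`. Nondegeneracy is taken
in the strong sense, `G x` identifying `E` with its dual, so that the Levi-Civita connection
exists in any dimension. -/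
structure IsMetricOn (G : E → E →L[ℝ] E →L[ℝ] ℝ) (Ω : Set E) : Prop where
  isOpen : IsOpen Ω
  contDiffOn : ContDiffOn ℝ ∞ G Ω
  symm : ∀ x ∈ Ω, ∀ v w, G x v w = G x w v
  isInvertible : ∀ x ∈ Ω, (G x).IsInvertible

namespace IsMetricOn

variable {Ω : Set E}

theorem contDiffAt (hG : IsMetricOn G Ω) (hx : x ∈ Ω) : ContDiffAt ℝ ∞ G x :=
  hG.contDiffOn.contDiffAt (hG.isOpen.mem_nhds hx)

theorem differentiableAt (hG : IsMetricOn G Ω) (hx : x ∈ Ω) : DifferentiableAt ℝ G x :=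
  (hG.contDiffAt hx).differentiableAt (by simp)

theorem fderiv_symm (hG : IsMetricOn G Ω) (hx : x ∈ Ω) (u v w : E) :
    fderiv ℝ G x u v w = fderiv ℝ G x u w v := by
  have hvw : (fun y ↦ G y v w) =ᶠ[𝓝 x] fun y ↦ G y w v := by
    filter_upwards [hG.isOpen.mem_nhds hx] with y hy using hG.symm y hy v w
  rw [← fderiv_bilin_apply_const (hG.differentiableAt hx),
    ← fderiv_bilin_apply_const (hG.differentiableAt hx), hvw.fderiv_eq]

theorem christoffel_symm (hG : IsMetricOn G Ω) (hx : x ∈ Ω) (v w : E) :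
    christoffel G x v w = christoffel G x w v := by
  refine christoffel_eq_of_apply_eq (hG.isInvertible x hx) ?_
  ext z
  rw [apply_christoffel (hG.isInvertible x hx), koszul_apply, koszul_apply,
    hG.fderiv_symm hx z v w]
  ring

theorem fderiv_eq_christoffel (hG : IsMetricOn G Ω) (hx : x ∈ Ω) (u v w : E) :
    fderiv ℝ G x u v w = G x (christoffel G x u v) w + G x v (christoffel G x u w) := by
  rw [hG.symm x hx v, apply_christoffel (hG.isInvertible x hx),
    apply_christoffel (hG.isInvertible x hx), koszul_apply, koszul_apply,
    hG.fderiv_symm hx w u v, hG.fderiv_symm hx v u w, hG.fderiv_symm hx u v w]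
  ring

variable [CompleteSpace E]

theorem contDiffAt_christoffel (hG : IsMetricOn G Ω) (hx : x ∈ Ω) :
    ContDiffAt ℝ ∞ (christoffel G) x :=
  CoordMetric.contDiffAt_christoffel (hG.contDiffAt hx) (hG.isInvertible x hx) (by simp)

theorem differentiableAt_christoffel (hG : IsMetricOn G Ω) (hx : x ∈ Ω) :
    DifferentiableAt ℝ (christoffel G) x :=
  (hG.contDiffAt_christoffel hx).differentiableAt (by simp)

theorem fderiv_apply_christoffel (hG : IsMetricOn G Ω) (hx : x ∈ Ω) (u v w z : E) :
    fderiv ℝ G x u (christoffel G x v w) z + G x (fderiv ℝ (christoffel G) x u v w) z =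
      fderiv ℝ (koszul G) x u v w z := by
  have hK : DifferentiableAt ℝ (koszul G) x :=
    (contDiffAt_koszul (n := ∞) (hG.contDiffAt hx) (by simp)).differentiableAt (by simp)
  have hΓ := hG.differentiableAt_christoffel hx
  have hspec : (fun y ↦ koszul G y v w z) =ᶠ[𝓝 x] fun y ↦ G y (christoffel G y v w) z := by
    filter_upwards [hG.isOpen.mem_nhds hx] with y hy
    rw [apply_christoffel (hG.isInvertible y hy)]
  rw [← fderiv_trilin_apply_const hK, hspec.fderiv_eq, fderiv_bilin_apply
    (hG.differentiableAt hx) ((hΓ.clm_apply (differentiableAt_const v)).clm_apply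
    (differentiableAt_const w)) (differentiableAt_const z), fderiv_bilin_apply_const hΓ]
  simp

end IsMetricOn

end Metric

section CompleteLift

variable {E F : Type*} [NormedAddCommGroup E] [NormedSpace ℝ E]
  [NormedAddCommGroup F] [NormedSpace ℝ F] {z : E × E}

/-- The complete lift of a field of bilinear maps `T` on `E` to the tangent bundle `E × E`: the
derivative of `(x, a, b) ↦ T x a b` at `(z.1, ξ.1, η.1)` in the direction `(z.2, ξ.2, η.2)`. -/
noncomputable def completeLiftBilin (T : E → E →L[ℝ] E →L[ℝ] F) (z : E × E) :
    E × E →L[ℝ] E × E →L[ℝ] F :=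
  (fderiv ℝ T z.1 z.2).bilinearComp (.fst ℝ E E) (.fst ℝ E E) +
    (T z.1).bilinearComp (.fst ℝ E E) (.snd ℝ E E) +
    (T z.1).bilinearComp (.snd ℝ E E) (.fst ℝ E E)

theorem completeLiftBilin_apply (T : E → E →L[ℝ] E →L[ℝ] F) (z ξ η : E × E) :
    completeLiftBilin T z ξ η =
      fderiv ℝ T z.1 z.2 ξ.1 η.1 + T z.1 ξ.1 η.2 + T z.1 ξ.2 η.1 := rfl

theorem contDiffAt_completeLiftBilin {m n : WithTop ℕ∞} {T : E → E →L[ℝ] E →L[ℝ] F}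
    (hT : ContDiffAt ℝ m T z.1) (hmn : n + 1 ≤ m) : ContDiffAt ℝ n (completeLiftBilin T) z := by
  have hT₁ : ContDiffAt ℝ n (fun y : E × E ↦ T y.1) z :=
    (hT.of_le (le_self_add.trans hmn)).comp z contDiffAt_fst
  have hDT : ContDiffAt ℝ n (fun y : E × E ↦ fderiv ℝ T y.1 y.2) z :=
    ((hT.fderiv_right hmn).comp z contDiffAt_fst).clm_apply contDiffAt_snd
  exact ((contDiffAt_bilinearComp hDT contDiffAt_const contDiffAt_const).add
    (contDiffAt_bilinearComp hT₁ contDiffAt_const contDiffAt_const)).add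
    (contDiffAt_bilinearComp hT₁ contDiffAt_const contDiffAt_const)

theorem fderiv_completeLiftBilin {T : E → E →L[ℝ] E →L[ℝ] F} (hT : ContDiffAt ℝ 2 T z.1)
    (ζ ξ η : E × E) :
    fderiv ℝ (completeLiftBilin T) z ζ ξ η =
      fderiv ℝ (fderiv ℝ T) z.1 ζ.1 z.2 ξ.1 η.1 + fderiv ℝ T z.1 ζ.2 ξ.1 η.1 +
        fderiv ℝ T z.1 ζ.1 ξ.1 η.2 + fderiv ℝ T z.1 ζ.1 ξ.2 η.1 := by
  have hT₁ : HasFDerivAt (fun y : E × E ↦ T y.1) _ z :=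
    (hT.differentiableAt (by simp)).hasFDerivAt.comp z hasFDerivAt_fst
  have hDT : HasFDerivAt (fun y : E × E ↦ fderiv ℝ T y.1) _ z :=
    (differentiableAt_fderiv hT).hasFDerivAt.comp z hasFDerivAt_fst
  have hT₁ab (a b : E) : HasFDerivAt (fun y : E × E ↦ T y.1 a b) _ z :=
    (hT₁.clm_apply (hasFDerivAt_const a z)).clm_apply (hasFDerivAt_const b z)
  have hlift : HasFDerivAt (fun y ↦ completeLiftBilin T y ξ η) _ z :=
    ((((hDT.clm_apply hasFDerivAt_snd).clm_apply (hasFDerivAt_const ξ.1 z)).clm_apply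
      (hasFDerivAt_const η.1 z)).add (hT₁ab ξ.1 η.2)).add (hT₁ab ξ.2 η.1)
  have hdiff : DifferentiableAt ℝ (completeLiftBilin T) z :=
    (contDiffAt_completeLiftBilin (n := 1) hT (by norm_num)).differentiableAt (by simp)
  rw [← fderiv_bilin_apply_const hdiff, hlift.fderiv]
  simp only [add_apply, ContinuousLinearMap.comp_apply, ContinuousLinearMap.flip_apply, zero_apply,
    map_zero, zero_add, ContinuousLinearMap.coe_fst', ContinuousLinearMap.coe_snd']
  abel

theorem isInvertible_completeLiftBilin {T : E → E →L[ℝ] E →L[ℝ] F} (hT : (T z.1).IsInvertible) :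
    (completeLiftBilin T z).IsInvertible := by
  obtain ⟨e, he⟩ := hT
  let fstInv : (E × E →L[ℝ] F) →L[ℝ] E :=
    (e.symm : (E →L[ℝ] F) →L[ℝ] E) ∘L .precomp F (.inr ℝ E E)
  let sndInv : (E × E →L[ℝ] F) →L[ℝ] E :=
    (e.symm : (E →L[ℝ] F) →L[ℝ] E) ∘L (.precomp F (.inl ℝ E E) - fderiv ℝ T z.1 z.2 ∘L fstInv)
  have hfst (ξ : E × E) : fstInv (completeLiftBilin T z ξ) = ξ.1 := by
    refine (e.symm_apply_eq).2 ?_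
    ext
    simp [completeLiftBilin_apply, ← he]
  have hsnd (ξ : E × E) : sndInv (completeLiftBilin T z ξ) = ξ.2 := by
    refine (e.symm_apply_eq).2 ?_
    ext
    simp [hfst, completeLiftBilin_apply, ← he]
  refine .of_inverse (g := fstInv.prod sndInv) (ContinuousLinearMap.ext fun l ↦ ?_)
    (ContinuousLinearMap.ext fun ξ ↦ Prod.ext (hfst ξ) (hsnd ξ))
  ext a
  · simp [completeLiftBilin_apply, ← he, fstInv, sndInv, ← Prod.zero_eq_mk]
  · simp [completeLiftBilin_apply, ← he, fstInv]

variable {G : E → E →L[ℝ] E →L[ℝ] ℝ} {Ω : Set E}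

theorem isMetricOn_completeLiftBilin (hG : IsMetricOn G Ω) :
    IsMetricOn (completeLiftBilin G) (Ω ×ˢ Set.univ) where
  isOpen := hG.isOpen.prod isOpen_univ
  contDiffOn _z hz :=
    (contDiffAt_completeLiftBilin (hG.contDiffAt hz.1) (by simp)).contDiffWithinAt
  symm z hz ξ η := by
    rw [completeLiftBilin_apply, completeLiftBilin_apply, hG.fderiv_symm hz.1 z.2 ξ.1,
      hG.symm _ hz.1 ξ.1, hG.symm _ hz.1 ξ.2]
    ring
  isInvertible z hz := isInvertible_completeLiftBilin (hG.isInvertible z.1 hz.1)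

namespace IsMetricOn

theorem koszul_completeLiftBilin (hG : IsMetricOn G Ω) (hz : z.1 ∈ Ω) (ξ η ζ : E × E) :
    koszul (completeLiftBilin G) z ξ η ζ =
      fderiv ℝ (koszul G) z.1 z.2 ξ.1 η.1 ζ.1 + koszul G z.1 ξ.2 η.1 ζ.1 +
        koszul G z.1 ξ.1 η.2 ζ.1 + koszul G z.1 ξ.1 η.1 ζ.2 := by
  have hG₂ : ContDiffAt ℝ 2 G z.1 := (hG.contDiffAt hz).of_le ENat.LEInfty.out
  simp only [koszul_apply, fderiv_completeLiftBilin hG₂, fderiv_koszul hG₂,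
    fderiv_fderiv_comm hG₂ z.2]
  ring

variable [CompleteSpace E]

theorem christoffel_completeLiftBilin (hG : IsMetricOn G Ω) (hz : z.1 ∈ Ω) (ξ η : E × E) :
    christoffel (completeLiftBilin G) z ξ η =
      (christoffel G z.1 ξ.1 η.1, completeLiftBilin (christoffel G) z ξ η) := by
  have hGz := hG.isInvertible z.1 hz
  refine christoffel_eq_of_apply_eq (isInvertible_completeLiftBilin hGz) ?_
  refine ContinuousLinearMap.ext fun ζ ↦ ?_
  rw [hG.koszul_completeLiftBilin hz, ← hG.fderiv_apply_christoffel hz, completeLiftBilin_apply,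
    completeLiftBilin_apply]
  simp only [map_add, add_apply, apply_christoffel hGz]
  ring

theorem fderiv_christoffel_completeLiftBilin (hG : IsMetricOn G Ω) (hz : z.1 ∈ Ω)
    (ζ ξ η : E × E) :
    fderiv ℝ (christoffel (completeLiftBilin G)) z ζ ξ η =
      (fderiv ℝ (christoffel G) z.1 ζ.1 ξ.1 η.1,
        fderiv ℝ (completeLiftBilin (christoffel G)) z ζ ξ η) := by
  have hz' : z ∈ Ω ×ˢ (Set.univ : Set E) := ⟨hz, Set.mem_univ _⟩
  have hΓ := hG.differentiableAt_christoffel hz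
  have hΓ₁ : DifferentiableAt ℝ (fun y : E × E ↦ christoffel G y.1 ξ.1 η.1) z :=
    ((hΓ.comp z differentiableAt_fst).clm_apply (differentiableAt_const _)).clm_apply
      (differentiableAt_const _)
  have hlift : DifferentiableAt ℝ (completeLiftBilin (christoffel G)) z :=
    (contDiffAt_completeLiftBilin (n := ∞) (hG.contDiffAt_christoffel hz)
      (by simp)).differentiableAt (by simp)
  have heq : (fun y ↦ christoffel (completeLiftBilin G) y ξ η) =ᶠ[𝓝 z]
      fun y ↦ (christoffel G y.1 ξ.1 η.1,
        completeLiftBilin (christoffel G) y ξ η) := by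
    filter_upwards [(isMetricOn_completeLiftBilin hG).isOpen.mem_nhds hz'] with y hy
      using hG.christoffel_completeLiftBilin hy.1 ξ η
  rw [← fderiv_bilin_apply_const
      ((isMetricOn_completeLiftBilin hG).differentiableAt_christoffel hz'),
    heq.fderiv_eq, hΓ₁.fderiv_prodMk ((hlift.clm_apply (differentiableAt_const ξ)).clm_apply
      (differentiableAt_const η)), ContinuousLinearMap.prod_apply,
    fderiv_bilin_apply_const hlift]
  congr 1
  rw [← fderiv_bilin_apply_const hΓ]
  exact fderiv_comp_fst ((hΓ.clm_apply (differentiableAt_const _)).clm_apply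
    (differentiableAt_const _)) ζ

end IsMetricOn

theorem fderiv_riemann {x : E} (hΓ : ContDiffAt ℝ 2 (christoffel G) x) (u v w y : E) :
    fderiv ℝ (fun x ↦ riemann G x u v w) x y =
      fderiv ℝ (fderiv ℝ (christoffel G)) x y u v w -
        fderiv ℝ (fderiv ℝ (christoffel G)) x y v u w +
        (fderiv ℝ (christoffel G) x y u (christoffel G x v w) +
          christoffel G x u (fderiv ℝ (christoffel G) x y v w)) -
        (fderiv ℝ (christoffel G) x y v (christoffel G x u w) +
          christoffel G x v (fderiv ℝ (christoffel G) x y u w)) := by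
  have hΓ' : HasFDerivAt (christoffel G) _ x := (hΓ.differentiableAt (by simp)).hasFDerivAt
  have hDΓ : HasFDerivAt (fderiv ℝ (christoffel G)) _ x := (differentiableAt_fderiv hΓ).hasFDerivAt
  have hDΓabc (a b c : E) : HasFDerivAt (fun y ↦ fderiv ℝ (christoffel G) y a b c) _ x :=
    ((hDΓ.clm_apply (hasFDerivAt_const a x)).clm_apply
      (hasFDerivAt_const b x)).clm_apply (hasFDerivAt_const c x)
  have hΓΓ (a b c : E) : HasFDerivAt (fun y ↦ christoffel G y a (christoffel G y b c)) _ x :=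
    (hΓ'.clm_apply (hasFDerivAt_const a x)).clm_apply
      ((hΓ'.clm_apply (hasFDerivAt_const b x)).clm_apply (hasFDerivAt_const c x))
  have hR : HasFDerivAt (fun x ↦ riemann G x u v w) _ x :=
    (((hDΓabc u v w).sub (hDΓabc v u w)).add (hΓΓ u v w)).sub (hΓΓ v u w)
  rw [hR.fderiv]
  simp only [add_apply, sub_apply, ContinuousLinearMap.comp_apply,
    ContinuousLinearMap.flip_apply, zero_apply, map_zero, zero_add]
  abel

theorem riemannEnd_apply (x u v w : E) : riemannEnd G x v w u = riemann G x u v w := rfl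

theorem riemann_zero (x v w : E) : riemann G x 0 v w = 0 := map_zero (riemannEnd G x v w)

theorem IsMetricOn.riemann_completeLiftBilin [CompleteSpace E] (hG : IsMetricOn G Ω)
    (hz : z.1 ∈ Ω) (ζ ξ η : E × E) :
    riemann (completeLiftBilin G) z ζ ξ η =
      (riemann G z.1 ζ.1 ξ.1 η.1,
        fderiv ℝ (fun x ↦ riemann G x ζ.1 ξ.1 η.1) z.1 z.2 + riemann G z.1 ζ.2 ξ.1 η.1 +
          riemann G z.1 ζ.1 ξ.2 η.1 + riemann G z.1 ζ.1 ξ.1 η.2) := by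
  have hΓ : ContDiffAt ℝ 2 (christoffel G) z.1 :=
    (hG.contDiffAt_christoffel hz).of_le ENat.LEInfty.out
  ext
  · simp only [riemann, hG.fderiv_christoffel_completeLiftBilin hz,
      hG.christoffel_completeLiftBilin hz, Prod.fst_add, Prod.fst_sub]
  · rw [fderiv_riemann hΓ]
    simp only [riemann, hG.fderiv_christoffel_completeLiftBilin hz,
      hG.christoffel_completeLiftBilin hz, Prod.snd_add, Prod.snd_sub, completeLiftBilin_apply,
      fderiv_completeLiftBilin hΓ, map_add, fderiv_fderiv_comm hΓ z.2]
    abel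

end CompleteLift

section Trace

theorem trace_inr_comp_comp_fst {R M N : Type*} [CommRing R] [AddCommGroup M] [Module R M]
    [Module.Free R M] [Module.Finite R M] [AddCommGroup N] [Module R N] [Module.Free R N]
    [Module.Finite R N] (T : M →ₗ[R] N) :
    LinearMap.trace R (M × N) (LinearMap.inr R M N ∘ₗ T ∘ₗ LinearMap.fst R M N) = 0 := by
  have hcomp : (T ∘ₗ LinearMap.fst R M N) ∘ₗ LinearMap.inr R M N = 0 := by
    ext
    simp
  rw [LinearMap.trace_comp_comm', hcomp, map_zero]

variable {E : Type*} [NormedAddCommGroup E] [NormedSpace ℝ E] [FiniteDimensional ℝ E]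
  {G : E → E →L[ℝ] E →L[ℝ] ℝ} {Ω : Set E} {z : E × E}

namespace IsMetricOn

theorem ricci_completeLiftBilin (hG : IsMetricOn G Ω) (hz : z.1 ∈ Ω) (ξ η : E × E) :
    ricci (completeLiftBilin G) z ξ η = 2 * ricci G z.1 ξ.1 η.1 := by
  have := FiniteDimensional.complete ℝ E
  set R := riemannEnd G z.1 ξ.1 η.1 with hR
  set S := riemannEnd (completeLiftBilin G) z ξ η with hS
  have hblock : S = R.prodMap R +
      LinearMap.inr ℝ E E ∘ₗ (LinearMap.snd ℝ E E ∘ₗ S ∘ₗ LinearMap.inl ℝ E E) ∘ₗ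
        LinearMap.fst ℝ E E := by
    refine LinearMap.ext fun ζ ↦ ?_
    simp only [hS, hR, LinearMap.add_apply, LinearMap.prodMap_apply, LinearMap.comp_apply,
      riemannEnd_apply, hG.riemann_completeLiftBilin hz, LinearMap.fst_apply,
      LinearMap.inl_apply, LinearMap.snd_apply, LinearMap.inr_apply, riemann_zero, Prod.mk_add_mk,
      add_zero, Prod.mk.injEq, true_and]
    abel
  rw [ricci_apply, ricci_apply, ← hS, ← hR, hblock, map_add, trace_inr_comp_comp_fst,
    LinearMap.trace_prodMap']
  ring

theorem scalar_completeLiftBilin (hG : IsMetricOn G Ω) (hz : z.1 ∈ Ω) :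
    scalar (completeLiftBilin G) z = 0 := by
  set S := (completeLiftBilin G z).inverse.toLinearMap ∘ₗ
    (LinearMap.toContinuousLinearMap (𝕜 := ℝ) (E := E × E) (F' := ℝ)).toLinearMap ∘ₗ
      ricci (completeLiftBilin G) z with hS
  have hGz := hG.isInvertible z.1 hz
  have hGLz := isInvertible_completeLiftBilin hGz
  have hS_apply (ξ η : E × E) :
      completeLiftBilin G z (S ξ) η = 2 * ricci G z.1 ξ.1 η.1 := by
    rw [← hG.ricci_completeLiftBilin hz, hS, LinearMap.comp_apply,
      ContinuousLinearMap.coe_coe, hGLz.self_apply_inverse]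
    rfl
  have hS_fst (ξ : E × E) : (S ξ).1 = 0 := by
    refine hGz.injective (ContinuousLinearMap.ext fun w ↦ ?_)
    simpa [completeLiftBilin_apply] using hS_apply ξ (0, w)
  have hS_vertical (b : E) : S (0, b) = 0 := by
    refine hGLz.injective (ContinuousLinearMap.ext fun ζ ↦ ?_)
    simpa using hS_apply (0, b) ζ
  have hblock : S = LinearMap.inr ℝ E E ∘ₗ
      (LinearMap.snd ℝ E E ∘ₗ S ∘ₗ LinearMap.inl ℝ E E) ∘ₗ LinearMap.fst ℝ E E := by
    ext <;> simp [hS_fst, hS_vertical]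
  rw [scalar, ← hS, hblock, trace_inr_comp_comp_fst]

end IsMetricOn

end Trace

section Pullback

variable {E F W : Type*} [NormedAddCommGroup E] [NormedSpace ℝ E]
  [NormedAddCommGroup F] [NormedSpace ℝ F] [NormedAddCommGroup W] [NormedSpace ℝ W]
  {φ : E → F} {T : F → F →L[ℝ] F →L[ℝ] W} {x : E}

/-- The pullback by `φ` of a field of bilinear maps. -/
noncomputable def pullback (φ : E → F) (T : F → F →L[ℝ] F →L[ℝ] W) (x : E) : E →L[ℝ] E →L[ℝ] W :=
  (T (φ x)).bilinearComp (fderiv ℝ φ x) (fderiv ℝ φ x)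

theorem pullback_apply (φ : E → F) (T : F → F →L[ℝ] F →L[ℝ] W) (x v w : E) :
    pullback φ T x v w = T (φ x) (fderiv ℝ φ x v) (fderiv ℝ φ x w) := rfl

theorem pullback_congr {ψ : E → F} {S : F → F →L[ℝ] F →L[ℝ] W} (hφψ : φ =ᶠ[𝓝 x] ψ)
    (hTS : T (φ x) = S (φ x)) : pullback φ T x = pullback ψ S x := by
  rw [pullback, pullback, hφψ.fderiv_eq, hTS, hφψ.eq_of_nhds]

/-- The map induced by `φ` on tangent bundles, which are identified with `E × E` and `F × F`. -/
noncomputable def tangentLift (φ : E → F) (z : E × E) : F × F := (φ z.1, fderiv ℝ φ z.1 z.2)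

theorem eventually_isInvertible_fderiv [CompleteSpace E] (hφ : ContDiffAt ℝ 1 φ x)
    (hDφ : (fderiv ℝ φ x).IsInvertible) : ∀ᶠ y in 𝓝 x, (fderiv ℝ φ y).IsInvertible := by
  obtain ⟨A, hA⟩ := hDφ
  have hcont : ContinuousAt (fderiv ℝ φ) x :=
    (hφ.fderiv_right (m := 0) (by norm_num)).continuousAt
  exact hcont.eventually (hA ▸ A.nhds)

theorem contDiffAt_pullback {m n : WithTop ℕ∞} (hφ : ContDiffAt ℝ m φ x)
    (hT : ContDiffAt ℝ n T (φ x)) (hmn : n + 1 ≤ m) : ContDiffAt ℝ n (pullback φ T) x :=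
  contDiffAt_bilinearComp (hT.comp x (hφ.of_le (le_self_add.trans hmn)))
    (hφ.fderiv_right hmn) (hφ.fderiv_right hmn)

theorem fderiv_pullback (hφ : ContDiffAt ℝ 2 φ x) (hT : ContDiffAt ℝ 1 T (φ x)) (u v w : E) :
    fderiv ℝ (pullback φ T) x u v w =
      fderiv ℝ T (φ x) (fderiv ℝ φ x u) (fderiv ℝ φ x v) (fderiv ℝ φ x w) +
        T (φ x) (fderiv ℝ (fderiv ℝ φ) x u v) (fderiv ℝ φ x w) +
        T (φ x) (fderiv ℝ φ x v) (fderiv ℝ (fderiv ℝ φ) x u w) := by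
  have hφ₁ : DifferentiableAt ℝ φ x := hφ.differentiableAt (by simp)
  have hT₁ : DifferentiableAt ℝ T (φ x) := hT.differentiableAt (by simp)
  have hDφ (v : E) : DifferentiableAt ℝ (fun y ↦ fderiv ℝ φ y v) x :=
    (differentiableAt_fderiv hφ).clm_apply (differentiableAt_const v)
  have hDDφ (v : E) : fderiv ℝ (fun y ↦ fderiv ℝ φ y v) x u = fderiv ℝ (fderiv ℝ φ) x u v := by
    simp [fderiv_clm_apply (differentiableAt_fderiv hφ) (differentiableAt_const v)]
  have hpullback : DifferentiableAt ℝ (pullback φ T) x :=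
    (contDiffAt_pullback hφ hT (by norm_num)).differentiableAt (by simp)
  rw [← fderiv_bilin_apply_const hpullback]
  simp only [pullback_apply]
  rw [fderiv_bilin_apply (B := fun y ↦ T (φ y)) (hT₁.comp x hφ₁) (hDφ v) (hDφ w), hDDφ, hDDφ,
    fderiv_fun_comp x hT₁ hφ₁, ContinuousLinearMap.comp_apply]

theorem fderiv_tangentLift {z : E × E} (hφ : ContDiffAt ℝ 2 φ z.1) (ξ : E × E) :
    fderiv ℝ (tangentLift φ) z ξ =
      (fderiv ℝ φ z.1 ξ.1, fderiv ℝ (fderiv ℝ φ) z.1 ξ.1 z.2 + fderiv ℝ φ z.1 ξ.2) := by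
  have hφ₁ : HasFDerivAt (fun y : E × E ↦ φ y.1) _ z :=
    (hφ.differentiableAt (by simp)).hasFDerivAt.comp z hasFDerivAt_fst
  have hDφ : HasFDerivAt (fun y : E × E ↦ fderiv ℝ φ y.1) _ z :=
    (differentiableAt_fderiv hφ).hasFDerivAt.comp z hasFDerivAt_fst
  have hlift : HasFDerivAt (tangentLift φ) _ z := hφ₁.prodMk (hDφ.clm_apply hasFDerivAt_snd)
  simp [hlift.fderiv, add_comm]

theorem completeLiftBilin_pullback {z : E × E} (hφ : ContDiffAt ℝ 2 φ z.1)
    (hT : ContDiffAt ℝ 1 T (φ z.1)) :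
    completeLiftBilin (pullback φ T) z = pullback (tangentLift φ) (completeLiftBilin T) z := by
  refine ContinuousLinearMap.ext fun ξ ↦ ContinuousLinearMap.ext fun η ↦ ?_
  simp only [completeLiftBilin_apply, pullback_apply, fderiv_pullback hφ hT,
    fderiv_tangentLift hφ, tangentLift, map_add, add_apply, fderiv_fderiv_comm hφ z.2]
  abel

variable {G : F → F →L[ℝ] F →L[ℝ] ℝ} {Ω : Set F}

theorem isInvertible_pullback (hφ : (fderiv ℝ φ x).IsInvertible) (hG : (G (φ x)).IsInvertible) :
    (pullback φ G x).IsInvertible := by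
  obtain ⟨A, hA⟩ := hφ
  obtain ⟨B, hB⟩ := hG
  refine ⟨A.trans (B.trans (A.arrowCongr (.refl ℝ ℝ)).symm), ?_⟩
  ext v w
  simp [pullback_apply, ← hA, ← hB, ContinuousLinearEquiv.arrowCongr]

namespace IsMetricOn

theorem koszul_pullback (hG : IsMetricOn G Ω) (hφ : ContDiffAt ℝ 2 φ x) (hx : φ x ∈ Ω)
    (u v w : E) :
    koszul (pullback φ G) x u v w =
      koszul G (φ x) (fderiv ℝ φ x u) (fderiv ℝ φ x v) (fderiv ℝ φ x w) +
        G (φ x) (fderiv ℝ (fderiv ℝ φ) x u v) (fderiv ℝ φ x w) := by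
  have hG₁ : ContDiffAt ℝ 1 G (φ x) := (hG.contDiffAt hx).of_le ENat.LEInfty.out
  simp only [koszul_apply, fderiv_pullback hφ hG₁]
  rw [fderiv_fderiv_comm hφ v u, fderiv_fderiv_comm hφ w u, fderiv_fderiv_comm hφ w v,
    hG.symm _ hx (fderiv ℝ φ x u), hG.symm _ hx (fderiv ℝ φ x v)]
  ring

theorem christoffel_pullback (hG : IsMetricOn G Ω) (hφ : ContDiffAt ℝ 2 φ x)
    (hDφ : (fderiv ℝ φ x).IsInvertible) (hx : φ x ∈ Ω) (u v : E) :
    fderiv ℝ φ x (christoffel (pullback φ G) x u v) =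
      fderiv ℝ (fderiv ℝ φ) x u v +
        christoffel G (φ x) (fderiv ℝ φ x u) (fderiv ℝ φ x v) := by
  have hGx := hG.isInvertible _ hx
  refine hGx.injective (ContinuousLinearMap.ext fun z ↦ ?_)
  obtain ⟨w, rfl⟩ := hDφ.surjective z
  rw [← pullback_apply, apply_christoffel (isInvertible_pullback hDφ hGx),
    hG.koszul_pullback hφ hx, map_add, add_apply, apply_christoffel hGx, add_comm]

variable [CompleteSpace E]

theorem differentiableAt_christoffel_pullback (hG : IsMetricOn G Ω) (hφ : ContDiffAt ℝ 3 φ x)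
    (hDφ : (fderiv ℝ φ x).IsInvertible) (hx : φ x ∈ Ω) :
    DifferentiableAt ℝ (christoffel (pullback φ G)) x :=
  (CoordMetric.contDiffAt_christoffel (m := 2) (n := 1)
    (contDiffAt_pullback hφ ((hG.contDiffAt hx).of_le ENat.LEInfty.out) (by norm_num))
    (isInvertible_pullback hDφ (hG.isInvertible _ hx)) (by norm_num)).differentiableAt (by simp)

variable [CompleteSpace F]

theorem fderiv_christoffel_pullback (hG : IsMetricOn G Ω) (hφ : ContDiffAt ℝ 3 φ x)
    (hDφ : (fderiv ℝ φ x).IsInvertible) (hx : φ x ∈ Ω) (u v w : E) :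
    fderiv ℝ (fderiv ℝ φ) x u (christoffel (pullback φ G) x v w) +
      fderiv ℝ φ x (fderiv ℝ (christoffel (pullback φ G)) x u v w) =
      fderiv ℝ (fderiv ℝ (fderiv ℝ φ)) x u v w +
        (fderiv ℝ (christoffel G) (φ x) (fderiv ℝ φ x u) (fderiv ℝ φ x v) (fderiv ℝ φ x w) +
          christoffel G (φ x) (fderiv ℝ (fderiv ℝ φ) x u v) (fderiv ℝ φ x w) +
          christoffel G (φ x) (fderiv ℝ φ x v) (fderiv ℝ (fderiv ℝ φ) x u w)) := by
  have hφ₂ : ContDiffAt ℝ 2 φ x := hφ.of_le (by norm_num)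
  have hD : ContDiffAt ℝ 2 (fderiv ℝ φ) x := hφ.fderiv_right (by norm_num)
  have hΓ : ContDiffAt ℝ 1 (christoffel G) (φ x) :=
    (hG.contDiffAt_christoffel hx).of_le ENat.LEInfty.out
  have hΓ' := hG.differentiableAt_christoffel_pullback hφ hDφ hx
  have hΓ'vw := (hΓ'.clm_apply (differentiableAt_const v)).clm_apply (differentiableAt_const w)
  have hΓφ : DifferentiableAt ℝ (pullback φ (christoffel G)) x :=
    (contDiffAt_pullback hφ₂ hΓ (by norm_num)).differentiableAt (by simp)
  have hΓφvw := (hΓφ.clm_apply (differentiableAt_const v)).clm_apply (differentiableAt_const w)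
  have hDDvw := ((differentiableAt_fderiv hD).clm_apply (differentiableAt_const v)).clm_apply
    (differentiableAt_const w)
  have heq : (fun y ↦ fderiv ℝ φ y (christoffel (pullback φ G) y v w)) =ᶠ[𝓝 x] fun y ↦
      fderiv ℝ (fderiv ℝ φ) y v w + pullback φ (christoffel G) y v w := by
    filter_upwards [hφ₂.eventually (by simp),
      eventually_isInvertible_fderiv (hφ.of_le (by norm_num)) hDφ,
      hφ.continuousAt (hG.isOpen.mem_nhds hx)] with y hφy hDφy hy
      using hG.christoffel_pullback hφy hDφy hy v w
  calc _ = fderiv ℝ (fun y ↦ fderiv ℝ φ y (christoffel (pullback φ G) y v w)) x u := by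
        rw [fderiv_clm_apply (differentiableAt_fderiv hφ₂) hΓ'vw,
          ← fderiv_bilin_apply_const hΓ']
        simp [add_comm]
    _ = fderiv ℝ (fderiv ℝ (fderiv ℝ φ)) x u v w +
          fderiv ℝ (pullback φ (christoffel G)) x u v w := by
        rw [heq.fderiv_eq, fderiv_fun_add hDDvw hΓφvw, add_apply,
          fderiv_bilin_apply_const (differentiableAt_fderiv hD), fderiv_bilin_apply_const hΓφ]
    _ = _ := by rw [fderiv_pullback hφ₂ hΓ]

theorem riemann_pullback (hG : IsMetricOn G Ω) (hφ : ContDiffAt ℝ 3 φ x)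
    (hDφ : (fderiv ℝ φ x).IsInvertible) (hx : φ x ∈ Ω) (u v w : E) :
    fderiv ℝ φ x (riemann (pullback φ G) x u v w) =
      riemann G (φ x) (fderiv ℝ φ x u) (fderiv ℝ φ x v) (fderiv ℝ φ x w) := by
  have hφ₂ : ContDiffAt ℝ 2 φ x := hφ.of_le (by norm_num)
  have hD : ContDiffAt ℝ 2 (fderiv ℝ φ) x := hφ.fderiv_right (by norm_num)
  simp only [riemann, map_add, map_sub, hG.christoffel_pullback hφ₂ hDφ hx,
    eq_sub_of_add_eq' (hG.fderiv_christoffel_pullback hφ hDφ hx _ _ _)]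
  rw [fderiv_fderiv_comm hD u v, fderiv_fderiv_comm hφ₂ v u]
  abel

end IsMetricOn

end Pullback

section Congr

variable {E : Type*} [NormedAddCommGroup E] [NormedSpace ℝ E]
  {G G' : E → E →L[ℝ] E →L[ℝ] ℝ} {x : E}

theorem completeLiftBilin_congr {z : E × E} (h : G =ᶠ[𝓝 z.1] G') :
    completeLiftBilin G z = completeLiftBilin G' z := by
  simp only [completeLiftBilin, h.fderiv_eq, h.eq_of_nhds]

theorem christoffel_congr (h : G =ᶠ[𝓝 x] G') : christoffel G =ᶠ[𝓝 x] christoffel G' := by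
  filter_upwards [h, h.fderiv (𝕜 := ℝ)] with y hy hy'
  simp only [christoffel, koszul, hy, hy']

theorem riemann_congr (h : G =ᶠ[𝓝 x] G') : riemann G x = riemann G' x := by
  ext u v w
  simp only [riemann, (christoffel_congr h).fderiv_eq, (christoffel_congr h).eq_of_nhds]

theorem ricci_congr (h : G =ᶠ[𝓝 x] G') : ricci G x = ricci G' x := by
  ext v w
  rw [ricci_apply, ricci_apply]
  congr 1
  ext u
  rw [riemannEnd_apply, riemannEnd_apply, riemann_congr h]

theorem scalar_congr [FiniteDimensional ℝ E] (h : G =ᶠ[𝓝 x] G') : scalar G x = scalar G' x := by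
  simp only [scalar, ricci_congr h, h.eq_of_nhds]

end Congr

end CoordMetric

section Charts

open CoordMetric

variable {E : Type*} [NormedAddCommGroup E] [NormedSpace ℝ E]
  {H : Type*} [TopologicalSpace H] (I : ModelWithCorners ℝ E H)
  {M : Type*} [TopologicalSpace M] [ChartedSpace H M]

/-- The change of coordinates from the preferred chart at `p` to the preferred chart at `q`. -/
noncomputable def chartTransition (p q : M) : PartialEquiv E E :=
  (extChartAt I p).symm ≫ extChartAt I q

variable {I} {p q : M} {x : E}

theorem chartTransition_apply (p q : M) (x : E) :
    chartTransition I p q x = extChartAt I q ((extChartAt I p).symm x) := rfl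

theorem extChartAt_symm_chartTransition (hx : x ∈ (chartTransition I p q).source) :
    (extChartAt I q).symm (chartTransition I p q x) = (extChartAt I p).symm x :=
  (extChartAt I q).left_inv hx.2

theorem chartTransition_mem_target (hx : x ∈ (chartTransition I p q).source) :
    chartTransition I p q x ∈ (extChartAt I q).target :=
  (extChartAt I q).map_source hx.2

theorem mem_source_chartTransition_extChartAt_symm (hx : x ∈ (extChartAt I p).target) :
    x ∈ (chartTransition I p ((extChartAt I p).symm x)).source :=
  ⟨hx, mem_extChartAt_source _⟩

theorem localMetric_apply (g : ∀ p : M, TangentSpace I p →L[ℝ] TangentSpace I p →L[ℝ] ℝ) (p : M)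
    (x v w : E) :
    localMetric I g p x v w = g ((extChartAt I p).symm x)
      (mfderiv 𝓘(ℝ, E) I (extChartAt I p).symm x v)
      (mfderiv 𝓘(ℝ, E) I (extChartAt I p).symm x w) := rfl

variable [I.Boundaryless]

theorem isOpen_chartTransition_source (p q : M) : IsOpen (chartTransition I p q).source :=
  (continuousOn_extChartAt_symm p).isOpen_inter_preimage (isOpen_extChartAt_target p)
    (isOpen_extChartAt_source q)

variable [IsManifold I ∞ M]

theorem contDiffAt_chartTransition (hx : x ∈ (chartTransition I p q).source) :
    ContDiffAt ℝ ∞ (chartTransition I p q) x :=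
  (contDiffOn_ext_coord_change q p).contDiffAt ((isOpen_chartTransition_source p q).mem_nhds hx)

theorem tangentCoordChange_eq_fderiv_chartTransition (p q r : M) :
    tangentCoordChange I p q r = fderiv ℝ (chartTransition I p q) (extChartAt I p r) := by
  rw [tangentCoordChange_def, I.range_eq_univ, fderivWithin_univ]
  rfl

theorem mdifferentiableAt_extChartAt_symm (hx : x ∈ (extChartAt I p).target) :
    MDifferentiableAt 𝓘(ℝ, E) I (extChartAt I p).symm x := by
  rw [← mdifferentiableWithinAt_univ, ← I.range_eq_univ]
  exact mdifferentiableWithinAt_extChartAt_symm hx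

theorem isInvertible_mfderiv_extChartAt_symm (hx : x ∈ (extChartAt I p).target) :
    (mfderiv 𝓘(ℝ, E) I (extChartAt I p).symm x).IsInvertible := by
  rw [← mfderivWithin_univ, ← I.range_eq_univ]
  exact isInvertible_mfderivWithin_extChartAt_symm hx

theorem isInvertible_fderiv_chartTransition (hx : x ∈ (chartTransition I p q).source) :
    (fderiv ℝ (chartTransition I p q) x).IsInvertible := by
  rw [← mfderiv_eq_fderiv]
  exact (mfderiv_comp x (mdifferentiableAt_extChartAt (I := I) (by simpa using hx.2))
    (mdifferentiableAt_extChartAt_symm hx.1)) ▸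
    (isInvertible_mfderiv_extChartAt hx.2).comp (isInvertible_mfderiv_extChartAt_symm hx.1)

theorem mfderiv_extChartAt_symm_eq_comp_fderiv_chartTransition
    (hx : x ∈ (chartTransition I p q).source) :
    mfderiv 𝓘(ℝ, E) I (extChartAt I p).symm x =
      (mfderiv 𝓘(ℝ, E) I (extChartAt I q).symm (chartTransition I p q x) : E →L[ℝ] E) ∘L
        fderiv ℝ (chartTransition I p q) x := by
  have heq : (extChartAt I p).symm =ᶠ[𝓝 x] (extChartAt I q).symm ∘ chartTransition I p q := by
    filter_upwards [(isOpen_chartTransition_source p q).mem_nhds hx] with y hy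
      using (extChartAt_symm_chartTransition hy).symm
  have hτ : MDifferentiableAt 𝓘(ℝ, E) 𝓘(ℝ, E) (chartTransition I p q) x :=
    ((contDiffAt_chartTransition hx).differentiableAt (by simp)).mdifferentiableAt
  rw [heq.mfderiv_eq, mfderiv_comp x
    (mdifferentiableAt_extChartAt_symm (chartTransition_mem_target hx)) hτ, mfderiv_eq_fderiv]
  rfl

variable (g : ∀ p : M, TangentSpace I p →L[ℝ] TangentSpace I p →L[ℝ] ℝ)

theorem localMetric_extChartAt (p : M) : localMetric I g p (extChartAt I p p) = g p := by
  refine ContinuousLinearMap.ext fun v ↦ ContinuousLinearMap.ext fun w ↦ ?_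
  rw [localMetric_apply, ← mfderivWithin_univ, ← I.range_eq_univ,
    mfderivWithin_range_extChartAt_symm, extChartAt_to_inv]
  rfl

theorem localMetric_eq_pullback (hx : x ∈ (chartTransition I p q).source) :
    localMetric I g p x = pullback (chartTransition I p q) (localMetric I g q) x := by
  refine ContinuousLinearMap.ext fun v ↦ ContinuousLinearMap.ext fun w ↦ ?_
  rw [pullback_apply, localMetric_apply, localMetric_apply,
    mfderiv_extChartAt_symm_eq_comp_fderiv_chartTransition hx,
    extChartAt_symm_chartTransition hx]
  rfl

theorem trivializationAt_bilin_apply (hq : q ∈ (extChartAt I p).source) :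
    (trivializationAt (E →L[ℝ] E →L[ℝ] ℝ)
      (fun q : M ↦ TangentSpace I q →L[ℝ] TangentSpace I q →L[ℝ] ℝ) p ⟨q, g q⟩).2 =
      localMetric I g p (extChartAt I p q) := by
  ext v w
  rw [localMetric_apply, (extChartAt I p).left_inv hq, ← mfderivWithin_univ, ← I.range_eq_univ]
  rw [extChartAt_source] at hq
  rw [← TangentBundle.symmL_trivializationAt hq, hom_trivializationAt_apply]
  simp only [ContinuousLinearMap.inCoordinates, ContinuousLinearMap.comp_apply]
  rw [Trivialization.continuousLinearMapAt_apply,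
    Trivialization.linearMapAt_apply, if_pos (by simpa using hq), hom_trivializationAt_apply]
  simp only [ContinuousLinearMap.inCoordinates, ContinuousLinearMap.comp_apply,
    Trivial.fiberBundle_trivializationAt', Trivial.continuousLinearMapAt_trivialization,
    ContinuousLinearMap.id_apply]
  rfl

theorem contMDiff_section_iff_contDiffOn_localMetric :
    ContMDiff I (I.prod 𝓘(ℝ, E →L[ℝ] E →L[ℝ] ℝ)) ∞
      (fun p ↦ TotalSpace.mk' (E →L[ℝ] E →L[ℝ] ℝ)
        (E := fun q : M ↦ TangentSpace I q →L[ℝ] TangentSpace I q →L[ℝ] ℝ) p (g p)) ↔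
    ∀ p : M, ContDiffOn ℝ ∞ (localMetric I g p) (extChartAt I p).target := by
  have hbase (p : M) : (extChartAt I p).source = (trivializationAt (E →L[ℝ] E →L[ℝ] ℝ)
      (fun q : M ↦ TangentSpace I q →L[ℝ] TangentSpace I q →L[ℝ] ℝ) p).baseSet := by
    simp
  constructor
  · intro h p
    have hcomponents := ((trivializationAt (E →L[ℝ] E →L[ℝ] ℝ)
      (fun q : M ↦ TangentSpace I q →L[ℝ] TangentSpace I q →L[ℝ] ℝ) p).contMDiffOn_section_iff
        (isOpen_extChartAt_source (I := I) p) (hbase p).subset).1 h.contMDiffOn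
    refine (contMDiffOn_iff_contDiffOn.1 (hcomponents.comp (contMDiffOn_extChartAt_symm p)
      fun x hx ↦ (extChartAt I p).map_target hx)).congr fun x hx ↦ ?_
    rw [Function.comp_apply, trivializationAt_bilin_apply g ((extChartAt I p).map_target hx),
      (extChartAt I p).right_inv hx]
  · intro h p
    rw [contMDiffAt_section]
    have hlocal : ContMDiffAt I 𝓘(ℝ, E →L[ℝ] E →L[ℝ] ℝ) ∞
        (localMetric I g p ∘ extChartAt I p) p :=
      ContMDiffAt.comp p (((h p).contDiffAt
        ((isOpen_extChartAt_target p).mem_nhds (mem_extChartAt_target p))).contMDiffAt)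
        contMDiffAt_extChartAt
    refine hlocal.congr_of_eventuallyEq ?_
    filter_upwards [extChartAt_source_mem_nhds (I := I) p] with q hq
      using trivializationAt_bilin_apply g hq

variable {g} [FiniteDimensional ℝ E]

theorem isInvertible_localMetric (hg : IsSemiRiemannianMetric I g)
    (hx : x ∈ (extChartAt I p).target) : (localMetric I g p x).IsInvertible := by
  have hx' := mem_source_chartTransition_extChartAt_symm hx
  rw [localMetric_eq_pullback g hx']
  refine isInvertible_pullback (isInvertible_fderiv_chartTransition hx') ?_
  rw [chartTransition_apply, localMetric_extChartAt]
  exact isInvertible_of_injective ((injective_iff_map_eq_zero _).2 fun v hv ↦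
    hg.nondegenerate _ v fun w ↦ DFunLike.congr_fun hv w)

theorem isMetricOn_localMetric (hg : IsSemiRiemannianMetric I g) (p : M) :
    IsMetricOn (localMetric I g p) (extChartAt I p).target where
  isOpen := isOpen_extChartAt_target p
  contDiffOn := (contMDiff_section_iff_contDiffOn_localMetric g).1 hg.contMDiff p
  symm x _ v w := by
    rw [localMetric_apply, localMetric_apply]
    exact hg.symm _ _ _
  isInvertible _ hx := isInvertible_localMetric hg hx

theorem riemann_localMetric_eq_zero (hg : IsSemiRiemannianMetric I g) (hflat : IsFlat I g)
    (hx : x ∈ (extChartAt I p).target) (u v w : E) :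
    riemann (localMetric I g p) x u v w = 0 := by
  set q := (extChartAt I p).symm x
  have hx' : x ∈ (chartTransition I p q).source := mem_source_chartTransition_extChartAt_symm hx
  have hpullback : localMetric I g p =ᶠ[𝓝 x]
      pullback (chartTransition I p q) (localMetric I g q) := by
    filter_upwards [(isOpen_chartTransition_source p q).mem_nhds hx'] with y hy
      using localMetric_eq_pullback g hy
  have hτ := isInvertible_fderiv_chartTransition hx'
  refine hτ.injective ?_
  rw [map_zero, riemann_congr hpullback, (isMetricOn_localMetric hg q).riemann_pullback
    ((contDiffAt_chartTransition hx').of_le ENat.LEInfty.out) hτ (chartTransition_mem_target hx')]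
  exact hflat q _ _ _

end Charts

section TangentBundleCharts

open CoordMetric

variable {E : Type*} [NormedAddCommGroup E] [NormedSpace ℝ E]
  {H : Type*} [TopologicalSpace H] {I : ModelWithCorners ℝ E H}
  {M : Type*} [TopologicalSpace M] [ChartedSpace H M] [IsManifold I ∞ M] {z : E × E}

theorem extChartAt_tangent_apply (U V : TangentBundle I M) :
    extChartAt I.tangent U V =
      (extChartAt I U.proj V.proj, tangentCoordChange I V.proj U.proj V.proj V.snd) := rfl

theorem extChartAt_tangent_self (U : TangentBundle I M) :
    extChartAt I.tangent U U = (extChartAt I U.proj U.proj, U.snd) :=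
  Prod.ext rfl (tangentCoordChange_self (E := E) (v := U.snd) (mem_extChartAt_source _))

theorem proj_extChartAt_tangent_symm (U : TangentBundle I M) (z : E × E) :
    ((extChartAt I.tangent U).symm z).proj = (extChartAt I U.proj).symm z.1 := rfl

theorem snd_extChartAt_tangent_symm (U : TangentBundle I M) (z : E × E) :
    ((extChartAt I.tangent U).symm z).snd =
      tangentCoordChange I U.proj ((extChartAt I U.proj).symm z.1)
        ((extChartAt I U.proj).symm z.1) z.2 := rfl

theorem extChartAt_tangent_target (U : TangentBundle I M) :
    (extChartAt I.tangent U).target = (extChartAt I U.proj).target ×ˢ Set.univ := by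
  rw [FiberBundle.extChartAt_target]
  congr 1
  refine Set.inter_eq_left.2 fun x hx ↦ ?_
  simpa using (extChartAt I U.proj).map_target hx

variable [I.Boundaryless]

theorem chartTransition_tangent (U V : TangentBundle I M)
    (hz : z.1 ∈ (chartTransition I U.proj V.proj).source) :
    chartTransition I.tangent U V z = tangentLift (chartTransition I U.proj V.proj) z := by
  have hp : extChartAt I U.proj ((extChartAt I U.proj).symm z.1) = z.1 :=
    (extChartAt I U.proj).right_inv hz.1
  rw [chartTransition_apply, extChartAt_tangent_apply, proj_extChartAt_tangent_symm,
    snd_extChartAt_tangent_symm, tangentCoordChange_comp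
      ⟨⟨(extChartAt I U.proj).map_target hz.1, mem_extChartAt_source _⟩, hz.2⟩,
    tangentCoordChange_eq_fderiv_chartTransition, hp]
  rfl

variable [FiniteDimensional ℝ E]
  {g : ∀ p : M, TangentSpace I p →L[ℝ] TangentSpace I p →L[ℝ] ℝ}

theorem completeLift_eq_completeLiftBilin (hg : IsSemiRiemannianMetric I g)
    (U : TangentBundle I M) :
    completeLift I g U =
      completeLiftBilin (localMetric I g U.proj) (extChartAt I.tangent U U) := by
  have hG := isMetricOn_localMetric hg U.proj
  have hU := mem_extChartAt_target (I := I) U.proj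
  refine ContinuousLinearMap.ext fun (ξ : E × E) ↦ ContinuousLinearMap.ext fun (η : E × E) ↦ ?_
  let B : E →L[ℝ] E →L[ℝ] ℝ := g U.proj
  let Γ : E →L[ℝ] E →L[ℝ] E := christoffelAt I g U.proj
  let y : E := U.snd
  have hUU : extChartAt I.tangent U U = (extChartAt I U.proj U.proj, y) :=
    extChartAt_tangent_self U
  have hDG : fderiv ℝ (localMetric I g U.proj) (extChartAt I U.proj U.proj) y ξ.1 η.1 =
      B (Γ ξ.1 y) η.1 + B ξ.1 (Γ η.1 y) := by
    rw [hG.fderiv_eq_christoffel hU, hG.christoffel_symm hU _ ξ.1, hG.christoffel_symm hU _ η.1,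
      localMetric_extChartAt]
    rfl
  calc B ξ.1 (η.2 + Γ η.1 y) + B (ξ.2 + Γ ξ.1 y) η.1
      = B (Γ ξ.1 y) η.1 + B ξ.1 (Γ η.1 y) + B ξ.1 η.2 + B ξ.2 η.1 := by
        simp only [map_add, add_apply]
        ring
    _ = completeLiftBilin (localMetric I g U.proj) (extChartAt I.tangent U U) ξ η := by
        rw [hUU, completeLiftBilin_apply, localMetric_extChartAt, ← hDG]

theorem localMetric_completeLift (hg : IsSemiRiemannianMetric I g) (U : TangentBundle I M)
    (hz : z.1 ∈ (extChartAt I U.proj).target) :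
    localMetric I.tangent (completeLift I g) U z =
      completeLiftBilin (localMetric I g U.proj) z := by
  have hzU : z ∈ (extChartAt I.tangent U).target := by
    rw [extChartAt_tangent_target]
    exact ⟨hz, Set.mem_univ _⟩
  set V := (extChartAt I.tangent U).symm z
  have hτ : z.1 ∈ (chartTransition I U.proj V.proj).source :=
    mem_source_chartTransition_extChartAt_symm hz
  have hpullback : localMetric I g U.proj =ᶠ[𝓝 z.1]
      pullback (chartTransition I U.proj V.proj) (localMetric I g V.proj) := by
    filter_upwards [(isOpen_chartTransition_source U.proj V.proj).mem_nhds hτ] with x hx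
      using localMetric_eq_pullback g hx
  have hlift : chartTransition I.tangent U V =ᶠ[𝓝 z]
      tangentLift (chartTransition I U.proj V.proj) := by
    filter_upwards [((isOpen_chartTransition_source U.proj V.proj).preimage
      continuous_fst).mem_nhds hτ] with ζ hζ using chartTransition_tangent U V hζ
  have hV : localMetric I.tangent (completeLift I g) V (chartTransition I.tangent U V z) =
      completeLiftBilin (localMetric I g V.proj) (chartTransition I.tangent U V z) := by
    rw [chartTransition_apply, localMetric_extChartAt, completeLift_eq_completeLiftBilin hg]
  calc localMetric I.tangent (completeLift I g) U z
      = pullback (chartTransition I.tangent U V)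
          (localMetric I.tangent (completeLift I g) V) z :=
        localMetric_eq_pullback _ (mem_source_chartTransition_extChartAt_symm hzU)
    _ = pullback (tangentLift (chartTransition I U.proj V.proj))
          (completeLiftBilin (localMetric I g V.proj)) z := pullback_congr hlift hV
    _ = completeLiftBilin (pullback (chartTransition I U.proj V.proj)
          (localMetric I g V.proj)) z :=
        (completeLiftBilin_pullback
          ((contDiffAt_chartTransition hτ).of_le ENat.LEInfty.out)
          (((isMetricOn_localMetric hg V.proj).contDiffAt
            (chartTransition_mem_target hτ)).of_le ENat.LEInfty.out)).symm
    _ = completeLiftBilin (localMetric I g U.proj) z := completeLiftBilin_congr hpullback.symm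

theorem isSemiRiemannianMetric_completeLift (hg : IsSemiRiemannianMetric I g) :
    IsSemiRiemannianMetric I.tangent (completeLift I g) where
  symm U ξ η := by
    rw [completeLift_eq_completeLiftBilin hg]
    exact (isMetricOn_completeLiftBilin (isMetricOn_localMetric hg U.proj)).symm
      (extChartAt I.tangent U U) ⟨mem_extChartAt_target U.proj, Set.mem_univ _⟩ ξ η
  nondegenerate U ξ h := by
    rw [completeLift_eq_completeLiftBilin hg] at h
    exact (injective_iff_map_eq_zero _).1
      ((isMetricOn_completeLiftBilin (isMetricOn_localMetric hg U.proj)).isInvertible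
        (extChartAt I.tangent U U) ⟨mem_extChartAt_target U.proj, Set.mem_univ _⟩).injective ξ
      (ContinuousLinearMap.ext h)
  contMDiff := by
    refine (contMDiff_section_iff_contDiffOn_localMetric (completeLift I g)).2 fun U ↦ ?_
    rw [extChartAt_tangent_target]
    exact (isMetricOn_completeLiftBilin (isMetricOn_localMetric hg U.proj)).contDiffOn.congr
      fun z hz ↦ localMetric_completeLift hg U hz.1

end TangentBundleCharts

section Curvature

open CoordMetric

variable {E : Type*} [NormedAddCommGroup E] [NormedSpace ℝ E] [FiniteDimensional ℝ E]
  {H : Type*} [TopologicalSpace H] {I : ModelWithCorners ℝ E H} [I.Boundaryless]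
  {M : Type*} [TopologicalSpace M] [ChartedSpace H M] [IsManifold I ∞ M]
  {g : ∀ p : M, TangentSpace I p →L[ℝ] TangentSpace I p →L[ℝ] ℝ}

theorem localMetric_completeLift_eventuallyEq (hg : IsSemiRiemannianMetric I g)
    (U : TangentBundle I M) :
    localMetric I.tangent (completeLift I g) U =ᶠ[𝓝 (extChartAt I.tangent U U)]
      completeLiftBilin (localMetric I g U.proj) := by
  filter_upwards [(isOpen_extChartAt_target (I := I.tangent) U).mem_nhds
    (mem_extChartAt_target U)] with z hz
  rw [extChartAt_tangent_target] at hz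
  exact localMetric_completeLift hg U hz.1

theorem riemannTensor_completeLift (hg : IsSemiRiemannianMetric I g) (U : TangentBundle I M)
    (ζ ξ η : E × E) :
    riemannTensor I.tangent (completeLift I g) U ζ ξ η =
      (riemann (localMetric I g U.proj) (extChartAt I U.proj U.proj) ζ.1 ξ.1 η.1,
        fderiv ℝ (fun x ↦ riemann (localMetric I g U.proj) x ζ.1 ξ.1 η.1)
            (extChartAt I U.proj U.proj) U.snd +
          riemann (localMetric I g U.proj) (extChartAt I U.proj U.proj) ζ.2 ξ.1 η.1 +
          riemann (localMetric I g U.proj) (extChartAt I U.proj U.proj) ζ.1 ξ.2 η.1 +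
          riemann (localMetric I g U.proj) (extChartAt I U.proj U.proj) ζ.1 ξ.1 η.2) := by
  change riemann (localMetric I.tangent (completeLift I g) U) (extChartAt I.tangent U U) ζ ξ η = _
  rw [riemann_congr (localMetric_completeLift_eventuallyEq hg U),
    (isMetricOn_localMetric hg U.proj).riemann_completeLiftBilin (mem_extChartAt_target U.proj),
    extChartAt_tangent_self]

theorem ricciTensor_completeLift (hg : IsSemiRiemannianMetric I g) (U : TangentBundle I M)
    (ξ η : E × E) :
    ricciTensor I.tangent (completeLift I g) U ξ η = 2 * ricciTensor I g U.proj ξ.1 η.1 := by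
  change ricci (localMetric I.tangent (completeLift I g) U) (extChartAt I.tangent U U) ξ η = _
  rw [ricci_congr (localMetric_completeLift_eventuallyEq hg U)]
  exact (isMetricOn_localMetric hg U.proj).ricci_completeLiftBilin
    (mem_extChartAt_target U.proj) ξ η

theorem isScalarFlat_completeLift (hg : IsSemiRiemannianMetric I g) :
    IsScalarFlat I.tangent (completeLift I g) := fun U ↦
  (scalar_congr (localMetric_completeLift_eventuallyEq hg U)).trans
    ((isMetricOn_localMetric hg U.proj).scalar_completeLiftBilin (mem_extChartAt_target U.proj))

theorem fderiv_riemann_localMetric_eq_zero (hg : IsSemiRiemannianMetric I g) (hflat : IsFlat I g)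
    (p : M) (u v w : E) :
    fderiv ℝ (fun x ↦ riemann (localMetric I g p) x u v w) (extChartAt I p p) = 0 := by
  have hR : (fun x ↦ riemann (localMetric I g p) x u v w) =ᶠ[𝓝 (extChartAt I p p)]
      fun _ ↦ (0 : E) := by
    filter_upwards [(isOpen_extChartAt_target (I := I) p).mem_nhds (mem_extChartAt_target p)]
      with x hx using riemann_localMetric_eq_zero hg hflat hx u v w
  rw [hR.fderiv_eq, fderiv_fun_const, Pi.zero_apply]

theorem isFlat_completeLift_iff (hg : IsSemiRiemannianMetric I g) :
    IsFlat I.tangent (completeLift I g) ↔ IsFlat I g := by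
  constructor
  · intro hflat p u v w
    exact congrArg Prod.fst ((riemannTensor_completeLift hg ⟨p, 0⟩ (u, 0) (v, 0) (w, 0)).symm.trans
      (hflat ⟨p, 0⟩ (u, 0) (v, 0) (w, 0)))
  · intro hflat U ζ ξ η
    have hR (u v w : E) :
        riemann (localMetric I g U.proj) (extChartAt I U.proj U.proj) u v w = 0 :=
      hflat U.proj u v w
    refine (riemannTensor_completeLift hg U ζ ξ η).trans ?_
    simp only [hR, fderiv_riemann_localMetric_eq_zero hg hflat, add_zero]
    rfl

theorem isRicciFlat_completeLift_iff (hg : IsSemiRiemannianMetric I g) :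
    IsRicciFlat I.tangent (completeLift I g) ↔ IsRicciFlat I g := by
  constructor
  · intro hflat p v w
    exact (mul_eq_zero_iff_left two_ne_zero).1
      ((ricciTensor_completeLift hg ⟨p, 0⟩ (v, 0) (w, 0)).symm.trans
        (hflat ⟨p, 0⟩ (v, 0) (w, 0)))
  · intro hflat U ξ η
    exact (ricciTensor_completeLift hg U ξ η).trans
      (mul_eq_zero_of_right 2 (hflat U.proj _ _))

end Curvature

theorem mainTheorem6
    {E : Type*} [NormedAddCommGroup E] [NormedSpace ℝ E] [FiniteDimensional ℝ E]
    {H : Type*} [TopologicalSpace H] (I : ModelWithCorners ℝ E H) [I.Boundaryless]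
    {M : Type*} [TopologicalSpace M] [ChartedSpace H M] [IsManifold I ∞ M]
    (g : ∀ p : M, TangentSpace I p →L[ℝ] TangentSpace I p →L[ℝ] ℝ)
    (hg : IsSemiRiemannianMetric I g) :
    IsSemiRiemannianMetric I.tangent (completeLift I g) ∧
    (IsFlat I.tangent (completeLift I g) ↔ IsFlat I g) ∧
    (IsRicciFlat I.tangent (completeLift I g) ↔ IsRicciFlat I g) ∧
    IsScalarFlat I.tangent (completeLift I g) :=
  ⟨isSemiRiemannianMetric_completeLift hg, isFlat_completeLift_iff hg,
    isRicciFlat_completeLift_iff hg, isScalarFlat_completeLift hg⟩
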